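/- Let $\mathrm{Simp}(\mathrm{Grp})$ be the category of simplicial groups. For a simplicial group $X$ let $M$ be its Moore complex: $M_0=X_0$, $M_k=\bigcap_{i=0}^{k-1}\ker(d_i\colon X_k\to X_{k-1})$ for $k\ge 1$, with differential $\delta_k=d_k|_{M_k}\colon M_k\to M_{k-1}$. Let $\mathcal M_{n\ge}$ (resp. $\mathcal M_{\ge n}$) be the full subcategory of simplicial groups with $M_k=0$ for all $k>n$ (resp. for all $k<n$). For $n\ge 0$ let $\mathrm{Cot}_n$ be the cotruncation functor on $\mathrm{Simp}(\mathrm{Grp})$: $\mathrm{Cot}_n(X)$ is the quotient of $X$ which is $X_i$ in degrees $i<n$, is $X_n/\delta_{n+1}(M_{n+1})$ in degree $n$, and in which, in the semidirect decomposition in higher degrees, all $M_k$ with $k>n$ are deleted and $M_n$ is replaced by $M_n/\delta_{n+1}(M_{n+1})$; that is, the quotient of $X$ by the normal simplicial subgroup of those $x\in X_i$ such that $\theta^*x\in\delta_{n+1}(M_{n+1})$ for every simplicial operator $\theta^*\colon X_i\to X_n$. Put $\mu_{n\ge}=(\ker(\mathrm{Cot}_n),\mathcal M_{n\ge})$, where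 $\ker(\mathrm{Cot}_n)=\{X\mid \mathrm{Cot}_n(X)\cong 0\}$. For $n\ge 1$ let $\mathrm{tr}_{n-1}\dashv\mathrm{cosk}_{n-1}$ be the truncation/coskeleton adjunction with unit $\eta$, and put $\mu_{\ge n}=(\{X\mid \mathrm{tr}_{n-1}(X)\cong 0\},\ \{X\mid \eta_X \text{ is a monomorphism}\})$. A torsion theory is a pair $(\mathcal T,\mathcal F)$ of full replete subcategories such that every morphism from an object of $\mathcal T$ to an object of $\mathcal F$ is zero and every object $X$ lies in a short exact sequence $0\to T\to X\to F\to 0$ with $T\in\mathcal T$, $F\in\mathcal F$. It is hereditary if $\mathcal T$ is closed under subobjects, and cohereditary if $\mathcal F$ is closed under quotients (targets of normal epimorphisms). A category is semi-abelian if it is pointed, Barr-exact, protomodular and has binary coproducts. Theorem. (1) For every $n\ge 0$, $\mu_{n\ge}$ is a cohereditary torsion theory in $\mathrm{Simp}(\mathrm{Grp})$. (2) For every $n\ge 1$, $\mu_{\ge n}$ is a hereditary torsion theory in $\mathrm{Simp}(\mathrm{Grp})$. (3) For every $n\ge 0$, the categories $\mathcal M_{n\ge}$ and $\mathcal M_{\ge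 n}$ are semi-abelian. -/

import Mathlib

open CategoryTheory CategoryTheory.Limits Opposite
open scoped Simplicial

universe v w u

/-! ### Semi-abelian categories -/

/-- Protomodularity in the sense of Bourn: for every `p : E ⟶ B`, the change-of-base functor
`p^* : Pt(B) ⥤ Pt(E)` between categories of points (split epimorphisms with a chosen section)
reflects isomorphisms. Here `g` is a morphism of points from `(f, s)` to `(f', s')` over `B`, and
the displayed morphism of pullbacks is `p^* g`. -/
def IsProtomodular (C : Type w) [Category.{v} C] [HasPullbacks C] : Prop :=
  ∀ ⦃E B A A' : C⦄ (p : E ⟶ B) (f : A ⟶ B) (s : B ⟶ A) (f' : A' ⟶ B) (s' : B ⟶ A')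
    (g : A ⟶ A') (_ : s ≫ f = 𝟙 B) (_ : s' ≫ f' = 𝟙 B) (hf : g ≫ f' = f) (_ : s ≫ g = s'),
    IsIso (pullback.map f p f' p g (𝟙 E) (𝟙 B) (by simp [hf]) (by simp)) → IsIso g

/-- A semi-abelian category: pointed, Barr-exact (regular, and every internal equivalence relation
is a kernel pair), protomodular, with binary coproducts. -/
structure IsSemiAbelian (C : Type w) [Category.{v} C] : Prop where
  regular : Regular C
  effective : ∀ ⦃R X : C⦄ (p₁ p₂ : R ⟶ X), IsEquivalenceRelation p₁ p₂ →
    ∃ (Y : C) (f : X ⟶ Y), IsKernelPair f p₁ p₂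
  pointed : HasZeroObject C
  protomodular : IsProtomodular C
  binaryCoproducts : HasBinaryCoproducts C

/-! ### Torsion theories -/

/-- `0 ⟶ K ⟶ X ⟶ Y ⟶ 0` is short exact: `k` is the kernel of `p` and `p` is the cokernel
of `k`. -/
def IsShortExactSeq {C : Type w} [Category.{v} C] [HasZeroMorphisms C] {K X Y : C}
    (k : K ⟶ X) (p : X ⟶ Y) : Prop :=
  ∃ h : k ≫ p = 0, Nonempty (IsLimit (KernelFork.ofι k h)) ∧
    Nonempty (IsColimit (CokernelCofork.ofπ p h))

/-- A pair of full subcategories of `C`. -/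
structure SubcategoryPair (C : Type w) [Category.{v} C] where
  torsion : ObjectProperty C
  torsionFree : ObjectProperty C

/-- The pair is a torsion theory. -/
structure SubcategoryPair.IsTorsionTheory {C : Type w} [Category.{v} C] [HasZeroMorphisms C]
    (P : SubcategoryPair C) : Prop where
  torsion_replete : P.torsion.IsClosedUnderIsomorphisms
  torsionFree_replete : P.torsionFree.IsClosedUnderIsomorphisms
  hom_eq_zero : ∀ ⦃T F : C⦄ (f : T ⟶ F), P.torsion T → P.torsionFree F → f = 0
  exists_ses : ∀ X : C, ∃ (T F : C) (k : T ⟶ X) (p : X ⟶ F),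
    P.torsion T ∧ P.torsionFree F ∧ IsShortExactSeq k p

/-- A hereditary torsion theory: the torsion subcategory is closed under subobjects. -/
structure SubcategoryPair.IsHereditaryTorsionTheory {C : Type w} [Category.{v} C]
    [HasZeroMorphisms C] (P : SubcategoryPair C) : Prop extends P.IsTorsionTheory where
  closed_sub : ∀ ⦃X Y : C⦄ (m : X ⟶ Y), Mono m → P.torsion Y → P.torsion X

/-- A cohereditary torsion theory: the torsion-free subcategory is closed under quotients
(targets of normal epimorphisms). -/
structure SubcategoryPair.IsCohereditaryTorsionTheory {C : Type w} [Category.{v} C]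
    [HasZeroMorphisms C] (P : SubcategoryPair C) : Prop extends P.IsTorsionTheory where
  closed_quot : ∀ ⦃X Y : C⦄ (p : X ⟶ Y), Nonempty (NormalEpi p) →
    P.torsionFree X → P.torsionFree Y

/-! ### Simplicial groups and the Moore complex -/

/-- The category of simplicial groups. -/
abbrev SimpGrp : Type (u + 1) := SimplicialObject GrpCat.{u}

instance : HasZeroMorphisms GrpCat.{u} where
  zero _ _ := ⟨GrpCat.ofHom 1⟩
  comp_zero _ _ := rfl
  zero_comp _ _ _ f := by
    ext x
    exact map_one f.hom

instance : HasZeroMorphisms SimpGrp.{u} :=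
  inferInstanceAs (HasZeroMorphisms (SimplexCategoryᵒᵖ ⥤ GrpCat.{u}))

namespace SimpGrp

/-- The `k`-th term `M_k = ⋂_{i < k} ker (d_i : X_k ⟶ X_{k-1})` of the Moore complex of `X`
(so `M_0 = X_0`), as a subgroup of `X_k`. -/
def moore (X : SimpGrp.{u}) (k : ℕ) : Subgroup (X _⦋k⦌) :=
  match k with
  | 0 => ⊤
  | k + 1 => ⨅ i : Fin (k + 1), (X.δ i.castSucc).hom.ker

/-- The image `δ_{k+1}(M_{k+1})` of the Moore differential (the restriction of the last face
`d_{k+1}`), as a subgroup of `X_k`. -/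
def mooreBoundary (X : SimpGrp.{u}) (k : ℕ) : Subgroup (X _⦋k⦌) :=
  (moore X (k + 1)).map (X.δ (Fin.last (k + 1))).hom

instance mooreBoundary_normal (X : SimpGrp.{u}) (k : ℕ) : (mooreBoundary X k).Normal := by
  have h1 : (moore X (k + 1)).Normal :=
    Subgroup.normal_iInf_normal fun i => MonoidHom.normal_ker _
  refine Subgroup.Normal.map h1 _ fun x => ⟨(X.σ (Fin.last k)).hom x, ?_⟩
  have h2 := X.δ_comp_σ_succ (i := Fin.last k)
  rw [Fin.succ_last] at h2
  simpa using ConcreteCategory.congr_hom h2 x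

/-- The full subcategory `M_{n≥}`: the Moore complex is trivial in degrees greater than `n`. -/
def mooreLE (n : ℕ) : ObjectProperty SimpGrp.{u} := fun X => ∀ k, n < k → moore X k = ⊥

/-- The full subcategory `M_{≥n}`: the Moore complex is trivial in degrees less than `n`. -/
def mooreGE (n : ℕ) : ObjectProperty SimpGrp.{u} := fun X => ∀ k, k < n → moore X k = ⊥

/-! ### The cotruncation functor and the torsion theory `μ_{n≥}` -/

/-- The normal simplicial subgroup of `X` divided out by the cotruncation functor `Cot_n`: the
elements all of whose images in degree `n` under simplicial operators lie in `δ_{n+1}(M_{n+1})`.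
It is trivial in degrees `< n`, equal to `δ_{n+1}(M_{n+1})` in degree `n`, and its Moore complex
contains `M_k` for all `k > n`. -/
def cotKernel (n : ℕ) (X : SimpGrp.{u}) (i : SimplexCategoryᵒᵖ) : Subgroup (X.obj i) :=
  ⨅ θ : i ⟶ op ⦋n⦌, (mooreBoundary X n).comap (X.map θ).hom

instance cotKernel_normal (n : ℕ) (X : SimpGrp.{u}) (i : SimplexCategoryᵒᵖ) :
    (cotKernel n X i).Normal :=
  Subgroup.normal_iInf_normal fun _ => Subgroup.Normal.comap inferInstance _

lemma cotKernel_le_comap_map (n : ℕ) (X : SimpGrp.{u}) {i j : SimplexCategoryᵒᵖ} (α : i ⟶ j) :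
    cotKernel n X i ≤ (cotKernel n X j).comap (X.map α).hom := by
  intro x hx
  simp only [cotKernel, Subgroup.mem_comap, Subgroup.mem_iInf] at hx ⊢
  intro θ
  have h := hx (α ≫ θ)
  rwa [X.map_comp] at h

lemma mooreBoundary_le_comap (n : ℕ) {X Y : SimpGrp.{u}} (f : X ⟶ Y) :
    mooreBoundary X n ≤ (mooreBoundary Y n).comap (f.app (op ⦋n⦌)).hom := by
  rintro _ ⟨x, hx, rfl⟩
  refine ⟨(f.app (op ⦋n + 1⦌)).hom x, ?_, ?_⟩
  · simp only [moore, SetLike.mem_coe, Subgroup.mem_iInf, MonoidHom.mem_ker] at hx ⊢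
    intro i
    have h := ConcreteCategory.congr_hom (SimplicialObject.δ_naturality f i.castSucc) x
    have h' : (f.app (op ⦋n⦌)).hom ((X.δ i.castSucc).hom x) = 1 := by rw [hx i, map_one]
    exact h.symm.trans h'
  · exact (ConcreteCategory.congr_hom (SimplicialObject.δ_naturality f (Fin.last (n + 1))) x).symm

lemma cotKernel_le_comap_app (n : ℕ) {X Y : SimpGrp.{u}} (f : X ⟶ Y) (i : SimplexCategoryᵒᵖ) :
    cotKernel n X i ≤ (cotKernel n Y i).comap (f.app i).hom := by
  intro x hx
  simp only [cotKernel, Subgroup.mem_comap, Subgroup.mem_iInf] at hx ⊢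
  intro θ
  have h := mooreBoundary_le_comap n f (hx θ)
  have h2 := ConcreteCategory.congr_hom (f.naturality θ) x
  rw [Subgroup.mem_comap] at h
  exact Eq.mp (congrArg (· ∈ mooreBoundary Y n) h2) h

/-- The simplicial group `Cot_n(X)`: the quotient of `X` which is `X_i` in degrees `i < n`,
`X_n / δ_{n+1}(M_{n+1})` in degree `n`, and in whose semidirect decomposition in higher degrees the
terms `M_k` with `k > n` are deleted and `M_n` is replaced by `M_n / δ_{n+1}(M_{n+1})`. -/
def cotObj (n : ℕ) (X : SimpGrp.{u}) : SimpGrp.{u} where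
  obj i := GrpCat.of (X.obj i ⧸ cotKernel n X i)
  map {i j} α := GrpCat.ofHom
    (QuotientGroup.map _ _ (X.map α).hom (cotKernel_le_comap_map n X α))
  map_id i := by
    ext x
    simp
  map_comp {i j k} α β := by
    ext x
    simp

/-- The cotruncation functor `Cot_n`. -/
def cot (n : ℕ) : SimpGrp.{u} ⥤ SimpGrp.{u} where
  obj X := cotObj n X
  map {X Y} f :=
    { app := fun i => GrpCat.ofHom
        (QuotientGroup.map _ _ (f.app i).hom (cotKernel_le_comap_app n f i))
      naturality := fun i j α => by
        ext x
        obtain ⟨x, rfl⟩ := QuotientGroup.mk_surjective x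
        exact congrArg QuotientGroup.mk (ConcreteCategory.congr_hom (f.naturality α) x) }
  map_id X := by
    ext i x
    obtain ⟨x, rfl⟩ := QuotientGroup.mk_surjective x
    rfl
  map_comp f g := by
    ext i x
    obtain ⟨x, rfl⟩ := QuotientGroup.mk_surjective x
    rfl

/-- The torsion theory `μ_{n≥} = (Ker(Cot_n), M_{n≥})`. -/
def muLE (n : ℕ) : SubcategoryPair SimpGrp.{u} where
  torsion X := IsZero ((cot n).obj X)
  torsionFree := mooreLE n

/-! ### The torsion theory `μ_{≥n}` -/

/-- The torsion theory `μ_{≥m+1}` induced by the localization `tr_m ⊣ cosk_m`: the torsion objects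
are the `X` with `tr_m(X) = 0`, the torsion-free ones are the `X` whose unit
`X ⟶ cosk_m(tr_m(X))` is a monomorphism. -/
noncomputable def muGESucc (m : ℕ) : SubcategoryPair SimpGrp.{u} where
  torsion X := IsZero ((SimplicialObject.truncation m).obj X)
  torsionFree X := Mono ((SimplicialObject.coskAdj m).unit.app X)

end SimpGrp

/-! Everything is computed on elements, degree by degree. The key fact is that a surjection of
simplicial groups stays surjective on each `moore X k` (`Surj.exists_mem_moore`).

For `muLE n`, divide X by `cotKernel n X`. It contains M_k for k > n (`moore_le_cotKernel`), so by
the key fact the quotient has no Moore terms above n. It also contains all of M_{n+1}, so its own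
boundary in degree n is that of X and `cot n` kills it. Morphisms from torsion to torsion-free
vanish because elements of a torsion-free F are detected in degree n (`eq_one_of_mooreLE`), where F
has trivial boundary. Closure under quotients is the key fact again.

For `muGESucc m`, the torsion part consists of the elements killed by all operators to degrees at
most m. By adjunction, composing with the unit remembers exactly the truncation of a morphism.

For semi-abelianness, vanishing of prescribed Moore terms defines a Birkhoff-type class
(`IsVariety`). In any such class limits are computed as in simplicial groups, regular epimorphisms
are the surjections, the usual group arguments give exactness and protomodularity, and coproducts
come by reflection. -/

namespace SimpGrp

variable {X Y Z : SimpGrp.{u}}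

/-! ### Simplicial subgroups, quotients and images -/

lemma naturality_apply (f : X ⟶ Y) {i j : SimplexCategoryᵒᵖ} (α : i ⟶ j) (x : X.obj i) :
    (f.app j).hom ((X.map α).hom x) = (Y.map α).hom ((f.app i).hom x) :=
  ConcreteCategory.congr_hom (f.naturality α) x

lemma hom_ext_apply {f g : X ⟶ Y} (h : ∀ i (x : X.obj i), (f.app i).hom x = (g.app i).hom x) :
    f = g := by
  ext i x
  exact h i x

/-- A morphism of simplicial groups is surjective in every degree. -/
def Surj (f : X ⟶ Y) : Prop := ∀ i, Function.Surjective (f.app i).hom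

/-- A morphism of simplicial groups is injective in every degree. -/
def Inj (f : X ⟶ Y) : Prop := ∀ i, Function.Injective (f.app i).hom

lemma Surj.cancel {f : X ⟶ Y} (hf : Surj f) {g h : Y ⟶ Z} (e : f ≫ g = f ≫ h) : g = h := by
  refine hom_ext_apply fun i y => ?_
  obtain ⟨x, rfl⟩ := hf i y
  exact ConcreteCategory.congr_hom (NatTrans.congr_app e i) x

lemma Inj.cancel {f : Y ⟶ Z} (hf : Inj f) {g h : X ⟶ Y} (e : g ≫ f = h ≫ f) : g = h :=
  hom_ext_apply fun i x => hf i (ConcreteCategory.congr_hom (NatTrans.congr_app e i) x)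

lemma isIso_of_inj_of_surj {f : X ⟶ Y} (h₁ : Inj f) (h₂ : Surj f) : IsIso f := by
  have h (i : SimplexCategoryᵒᵖ) : IsIso (f.app i) := by
    rw [ConcreteCategory.isIso_iff_bijective]
    exact ⟨h₁ i, h₂ i⟩
  exact NatIso.isIso_of_isIso_app f

lemma Surj.of_isIso (f : X ⟶ Y) [IsIso f] : Surj f := fun i => by
  have h : IsIso (f.app i) := inferInstance
  rw [ConcreteCategory.isIso_iff_bijective] at h
  exact h.2

lemma Inj.of_isIso (f : X ⟶ Y) [IsIso f] : Inj f := fun i => by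
  have h : IsIso (f.app i) := inferInstance
  rw [ConcreteCategory.isIso_iff_bijective] at h
  exact h.1

lemma Inj.of_mono (f : X ⟶ Y) [Mono f] : Inj f := fun i => by
  have h : Mono (f.app i) := inferInstance
  exact (GrpCat.mono_iff_injective _).1 h

/-- A morphism which is trivial on the kernel of a surjection factors through it. -/
lemma Surj.exists_desc {p : X ⟶ Y} (hp : Surj p) (g : X ⟶ Z)
    (h : ∀ i (x : X.obj i), (p.app i).hom x = 1 → (g.app i).hom x = 1) :
    ∃ l : Y ⟶ Z, p ≫ l = g := by
  let l (i : SimplexCategoryᵒᵖ) : Y.obj i →* Z.obj i :=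
    (p.app i).hom.liftOfSurjective (hp i) ⟨(g.app i).hom, fun x hx => h i x hx⟩
  have hl (i) (x : X.obj i) : l i ((p.app i).hom x) = (g.app i).hom x :=
    (p.app i).hom.liftOfRightInverse_comp_apply _ _ ⟨(g.app i).hom, fun x hx => h i x hx⟩ x
  refine ⟨{ app := fun i => GrpCat.ofHom (l i), naturality := fun i j α => ?_ }, ?_⟩
  · ext y
    obtain ⟨x, rfl⟩ := hp i y
    change l j ((Y.map α).hom ((p.app i).hom x)) = (Z.map α).hom (l i ((p.app i).hom x))
    rw [← naturality_apply, hl, hl, naturality_apply]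
  · exact hom_ext_apply hl

/-- A morphism whose values lie in the image of an injection factors through it. -/
lemma Inj.exists_lift {m : Y ⟶ Z} (hm : Inj m) (g : X ⟶ Z)
    (h : ∀ i (x : X.obj i), ∃ y, (m.app i).hom y = (g.app i).hom x) :
    ∃ l : X ⟶ Y, l ≫ m = g := by
  choose l hl using h
  refine ⟨{ app := fun i => GrpCat.ofHom (MonoidHom.mk' (l i) fun x y => hm i ?_),
            naturality := fun i j α => ?_ }, hom_ext_apply hl⟩
  · rw [map_mul, hl, hl, hl, map_mul]
  · ext x
    apply hm j
    change (m.app j).hom (l j ((X.map α).hom x)) = (m.app j).hom ((Y.map α).hom (l i x))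
    rw [naturality_apply, hl, hl, naturality_apply]

/-- A simplicial subgroup of a simplicial group. -/
structure SimplicialSubgroup (X : SimpGrp.{u}) where
  /-- the subgroup in each degree -/
  carrier : ∀ i, Subgroup (X.obj i)
  le_comap : ∀ {i j} (α : i ⟶ j), carrier i ≤ (carrier j).comap (X.map α).hom

namespace SimplicialSubgroup

variable (N : SimplicialSubgroup X)

/-- The underlying simplicial group of a simplicial subgroup. -/
def toSimpGrp : SimpGrp.{u} where
  obj i := GrpCat.of (N.carrier i)
  map {i j} α := GrpCat.ofHom
    (((X.map α).hom.comp (N.carrier i).subtype).codRestrict (N.carrier j)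
      fun x => N.le_comap α x.2)
  map_id i := by
    ext x
    exact ConcreteCategory.congr_hom (X.map_id i) x.1
  map_comp α β := by
    ext x
    exact ConcreteCategory.congr_hom (X.map_comp α β) x.1

/-- The inclusion of a simplicial subgroup. -/
def incl : N.toSimpGrp ⟶ X where
  app i := GrpCat.ofHom (N.carrier i).subtype
  naturality _ _ _ := rfl

lemma incl_inj : Inj N.incl := fun _ => Subtype.val_injective

section Quotient

variable [∀ i, (N.carrier i).Normal]

/-- The quotient of a simplicial group by a normal simplicial subgroup. -/
def quot : SimpGrp.{u} where
  obj i := GrpCat.of (X.obj i ⧸ N.carrier i)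
  map {i j} α := GrpCat.ofHom (QuotientGroup.map _ _ (X.map α).hom (N.le_comap α))
  map_id i := by
    ext x
    simp
  map_comp {i j k} α β := by
    ext x
    simp

/-- The projection onto the quotient by a normal simplicial subgroup. -/
def proj : X ⟶ N.quot where
  app i := GrpCat.ofHom (QuotientGroup.mk' (N.carrier i))
  naturality _ _ _ := rfl

lemma proj_surj : Surj N.proj := fun _ => QuotientGroup.mk_surjective

lemma proj_eq_one_iff {i : SimplexCategoryᵒᵖ} (x : X.obj i) :
    (N.proj.app i).hom x = 1 ↔ x ∈ N.carrier i :=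
  QuotientGroup.eq_one_iff x

variable {N} in
lemma exists_lift_incl {W : SimpGrp.{u}} (g : W ⟶ X) (hg : g ≫ N.proj = 0) :
    ∃ l, l ≫ N.incl = g :=
  N.incl_inj.exists_lift g fun i x =>
    ⟨⟨(g.app i).hom x, (N.proj_eq_one_iff _).1
      (ConcreteCategory.congr_hom (NatTrans.congr_app hg i) x)⟩, rfl⟩

variable {N} in
lemma exists_desc_proj {W : SimpGrp.{u}} (g : X ⟶ W) (hg : N.incl ≫ g = 0) :
    ∃ l, N.proj ≫ l = g :=
  N.proj_surj.exists_desc g fun i x hx =>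
    ConcreteCategory.congr_hom (NatTrans.congr_app hg i)
      (⟨x, (N.proj_eq_one_iff _).1 hx⟩ : N.carrier i)

lemma isShortExactSeq : IsShortExactSeq N.incl N.proj := by
  have h0 : N.incl ≫ N.proj = 0 :=
    hom_ext_apply fun i x => (N.proj_eq_one_iff x.1).2 x.2
  refine ⟨h0, ⟨KernelFork.IsLimit.ofι _ _ (fun {W} g hg => (exists_lift_incl g hg).choose)
    (fun {W} g hg => (exists_lift_incl g hg).choose_spec)
    (fun {W} g hg l hl => N.incl_inj.cancel (hl.trans (exists_lift_incl g hg).choose_spec.symm))⟩,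
    ⟨CokernelCofork.IsColimit.ofπ _ _ (fun {W} g hg => (exists_desc_proj g hg).choose)
    (fun {W} g hg => (exists_desc_proj g hg).choose_spec)
    (fun {W} g hg l hl => N.proj_surj.cancel (hl.trans (exists_desc_proj g hg).choose_spec.symm))⟩⟩

end Quotient

end SimplicialSubgroup

/-- The image of a morphism of simplicial groups. -/
def range (f : X ⟶ Y) : SimplicialSubgroup Y where
  carrier i := (f.app i).hom.range
  le_comap {i j} α := by
    rintro _ ⟨x, rfl⟩
    exact ⟨(X.map α).hom x, naturality_apply f α x⟩

/-- The corestriction of a morphism to its image. -/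
def toRange (f : X ⟶ Y) : X ⟶ (range f).toSimpGrp where
  app i := GrpCat.ofHom (f.app i).hom.rangeRestrict
  naturality i j α := by
    ext x
    exact Subtype.ext (naturality_apply f α x)

lemma toRange_surj (f : X ⟶ Y) : Surj (toRange f) := fun i =>
  (f.app i).hom.rangeRestrict_surjective

lemma toRange_incl (f : X ⟶ Y) : toRange f ≫ (range f).incl = f := rfl

/-- A morphism is surjective if the inclusion of its image has a section. -/
lemma Surj.of_section_incl {f : X ⟶ Y} {s : Y ⟶ (range f).toSimpGrp}
    (h : s ≫ (range f).incl = 𝟙 Y) : Surj f := fun i y => by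
  have h' : ((s.app i).hom y).1 = y := ConcreteCategory.congr_hom (NatTrans.congr_app h i) y
  obtain ⟨x, hx⟩ := ((s.app i).hom y).2
  exact ⟨x, hx.trans h'⟩

lemma isZero_iff : IsZero X ↔ ∀ i, Subsingleton (X.obj i) := by
  rw [show IsZero X ↔ ∀ i, IsZero (X.obj i) from Functor.isZero_iff X]
  exact forall_congr' fun i => GrpCat.isZero_iff_subsingleton

/-! ### Normalization -/

lemma app_mem_moore (f : X ⟶ Y) {k : ℕ} {x : X _⦋k⦌} (hx : x ∈ moore X k) :
    (f.app (op ⦋k⦌)).hom x ∈ moore Y k := by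
  cases k with
  | zero => trivial
  | succ k =>
    simp only [moore, Subgroup.mem_iInf, MonoidHom.mem_ker] at hx ⊢
    intro i
    have h := naturality_apply f (SimplexCategory.δ i.castSucc).op x
    refine h.symm.trans ?_
    erw [hx i]
    exact map_one _

lemma δ_σ_self_apply (X : SimpGrp.{u}) {k : ℕ} (j : Fin (k + 1)) (x : X _⦋k⦌) :
    (X.δ j.castSucc).hom ((X.σ j).hom x) = x :=
  ConcreteCategory.congr_hom (X.δ_comp_σ_self (i := j)) x

/-- For `i < j`, if `d_i x = 1` then `d_i s_j d_j x = 1`. -/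
lemma δ_σ_δ_apply (X : SimpGrp.{u}) {k : ℕ} {i j : Fin (k + 1)} (hij : i < j) (x : X _⦋k + 1⦌)
    (hx : (X.δ i.castSucc).hom x = 1) :
    (X.δ i.castSucc).hom ((X.σ j).hom ((X.δ j.castSucc).hom x)) = 1 := by
  obtain ⟨k, rfl⟩ : ∃ m, k = m + 1 := ⟨k - 1, by have := j.2; have := Fin.lt_def.1 hij; omega⟩
  obtain ⟨j, rfl⟩ := Fin.exists_succ_eq.2 (Fin.ne_zero_of_lt hij)
  obtain ⟨i, rfl⟩ := Fin.exists_castSucc_eq.2 (Fin.ne_last_of_lt hij)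
  have hij' : i ≤ j := by
    rw [Fin.lt_def] at hij
    rw [Fin.le_def]
    simp at hij
    omega
  -- After the index shift: d_i s_{j+1} = s_j d_i and d_i d_{j+1} = d_j d_i, which brings d_i x to
  -- the front.
  have h1 := ConcreteCategory.congr_hom
    (X.δ_comp_σ_of_le (i := i.castSucc) (j := j) (by simpa using hij'))
    ((X.δ j.succ.castSucc).hom x)
  have h2 := ConcreteCategory.congr_hom
    (X.δ_comp_δ (i := i.castSucc) (j := j.castSucc) (by simpa using hij')) x
  refine h1.trans ?_
  have h3 : (X.δ i.castSucc).hom ((X.δ j.succ.castSucc).hom x) = 1 := by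
    rw [← Fin.succ_castSucc]
    exact h2.trans ((congrArg (X.δ j.castSucc).hom hx).trans (map_one _))
  exact (congrArg (X.σ j).hom h3).trans (map_one _)

/-- Normalization preserves surjections. -/
lemma Surj.exists_mem_moore {f : X ⟶ Y} (hf : Surj f) {k : ℕ} {y : Y _⦋k⦌}
    (hy : y ∈ moore Y k) : ∃ x ∈ moore X k, (f.app (op ⦋k⦌)).hom x = y := by
  cases k with
  | zero =>
    obtain ⟨x, hx⟩ := hf _ y
    exact ⟨x, trivial, hx⟩
  | succ k =>
    simp only [moore, Subgroup.mem_iInf, MonoidHom.mem_ker] at hy ⊢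
    -- An arbitrary preimage is corrected one face at a time.
    suffices H : ∀ m ≤ k + 1, ∃ x : X _⦋k + 1⦌,
        (∀ i : Fin (k + 1), i.1 < m → (X.δ i.castSucc).hom x = 1) ∧
          (f.app (op ⦋k + 1⦌)).hom x = y by
      obtain ⟨x, hx, h⟩ := H (k + 1) le_rfl
      exact ⟨x, fun i => hx i i.2, h⟩
    intro m
    induction m with
    | zero =>
      obtain ⟨x, hx⟩ := hf _ y
      exact fun _ => ⟨x, fun _ h => absurd h (Nat.not_lt_zero _), hx⟩
    | succ m ih =>
      intro hm
      obtain ⟨x, hx, h⟩ := ih (by omega)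
      let j : Fin (k + 1) := ⟨m, by omega⟩
      -- The factor kills d_j since d_j s_j = 1, keeps the earlier faces trivial by `δ_σ_δ_apply`,
      -- and maps to 1 in Y since d_j y = 1.
      refine ⟨x * ((X.σ j).hom ((X.δ j.castSucc).hom x))⁻¹, fun i hi => ?_, ?_⟩
      · rw [map_mul, map_inv]
        obtain hi' | hi' := (Nat.lt_succ_iff.1 hi).lt_or_eq
        · rw [hx i hi', δ_σ_δ_apply X (Fin.lt_def.2 hi') x (hx i hi'), inv_one, mul_one]
        · obtain rfl : i = j := Fin.ext hi'
          rw [δ_σ_self_apply, mul_inv_cancel]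
      · rw [map_mul, map_inv, h]
        have h1 := naturality_apply f (SimplexCategory.σ j).op ((X.δ j.castSucc).hom x)
        have h2 := naturality_apply f (SimplexCategory.δ j.castSucc).op x
        have h3 : (f.app (op ⦋k + 1⦌)).hom ((X.σ j).hom ((X.δ j.castSucc).hom x)) = 1 := by
          refine h1.trans ?_
          erw [h2, h, hy j]
          exact map_one _
        rw [h3, inv_one, mul_one]

end SimpGrp

namespace SimpGrp

variable {X Y Z : SimpGrp.{u}}

lemma mem_moore_of_inj {f : X ⟶ Y} (hf : Inj f) {k : ℕ} {x : X _⦋k⦌}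
    (hx : (f.app (op ⦋k⦌)).hom x ∈ moore Y k) : x ∈ moore X k := by
  cases k with
  | zero => trivial
  | succ k =>
    simp only [moore, Subgroup.mem_iInf, MonoidHom.mem_ker] at hx ⊢
    intro i
    apply hf _
    rw [map_one]
    exact (naturality_apply f (SimplexCategory.δ i.castSucc).op x).trans (hx i)

/-- The corestriction to the image kills whatever p is the cokernel of, so it factors through p and
yields a section of the image inclusion. -/
lemma surj_of_normalEpi {p : X ⟶ Y} (hp : Nonempty (NormalEpi p)) : Surj p := by
  obtain ⟨hp⟩ := hp
  have : Epi p := epi_of_isColimit_cofork hp.isColimit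
  have h : hp.g ≫ toRange p = 0 := (range p).incl_inj.cancel (by
    rw [Category.assoc, toRange_incl, hp.w, zero_comp])
  obtain ⟨s, hs⟩ := CokernelCofork.IsColimit.desc' hp.isColimit (toRange p) h
  replace hs : p ≫ s = toRange p := hs
  refine Surj.of_section_incl (s := s) ?_
  rw [← cancel_epi p, ← Category.assoc, hs, toRange_incl, Category.comp_id]

/-! ### The torsion theory `μ_{n≥}` -/

/-- An operator from degree k to degree n either factors through a face d_i with i < k, which kills
Moore elements, or is the last face itself, with k = n + 1, whose value is a boundary by definition.
-/
lemma moore_le_cotKernel {n k : ℕ} (hk : n < k) : moore X k ≤ cotKernel n X (op ⦋k⦌) := by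
  obtain ⟨k, rfl⟩ : ∃ m, k = m + 1 := ⟨k - 1, by omega⟩
  intro x hx
  simp only [cotKernel, Subgroup.mem_iInf, Subgroup.mem_comap]
  intro θ
  by_cases h : ∃ i : Fin (k + 1), ∀ y, θ.unop.toOrderHom y ≠ i.castSucc
  · obtain ⟨i, hi⟩ := h
    obtain ⟨θ', hθ'⟩ := SimplexCategory.eq_comp_δ_of_not_surjective' θ.unop i.castSucc hi
    obtain rfl : θ = (SimplexCategory.δ i.castSucc).op ≫ θ'.op := Quiver.Hom.unop_inj hθ'
    simp only [moore, Subgroup.mem_iInf, MonoidHom.mem_ker] at hx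
    rw [X.map_comp]
    have : (X.map θ'.op).hom ((X.δ i.castSucc).hom x) = 1 := by rw [hx i, map_one]
    have h1 : (X.map (SimplexCategory.δ i.castSucc).op ≫ X.map θ'.op).hom x = 1 := this
    rw [h1]
    exact one_mem _
  · push Not at h
    -- Otherwise θ would map n + 1 vertices onto k + 2, although n ≤ k.
    have hlast (y) : θ.unop.toOrderHom y ≠ Fin.last (k + 1) := by
      intro hy
      have hs : Function.Surjective θ.unop.toOrderHom := by
        intro z
        induction z using Fin.lastCases with
        | last => exact ⟨y, hy⟩
        | cast i => exact h i
      have := Fintype.card_le_of_surjective _ hs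
      simp at this
      omega
    obtain ⟨θ', hθ'⟩ := SimplexCategory.eq_comp_δ_of_not_surjective' θ.unop _ hlast
    obtain rfl : θ = (SimplexCategory.δ (Fin.last (k + 1))).op ≫ θ'.op := Quiver.Hom.unop_inj hθ'
    have hs : Function.Surjective θ'.toOrderHom := by
      intro z
      obtain ⟨y, hy⟩ := h z
      refine ⟨y, Fin.castSucc_injective _ ?_⟩
      rw [← hy]
      exact (Fin.succAbove_last_apply _).symm
    obtain rfl : n = k := by
      have := Fintype.card_le_of_surjective _ hs
      simp at this
      omega
    have : Epi θ' := SimplexCategory.epi_iff_surjective.2 hs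
    rw [SimplexCategory.eq_id_of_epi θ', op_id, Category.comp_id]
    exact ⟨x, hx, rfl⟩

/-- The kernel of the projection onto `Cot_n(X)`. -/
def cotKer (n : ℕ) (X : SimpGrp.{u}) : SimplicialSubgroup X where
  carrier := cotKernel n X
  le_comap := cotKernel_le_comap_map n X

instance (n : ℕ) (X : SimpGrp.{u}) (i) : ((cotKer n X).carrier i).Normal :=
  cotKernel_normal n X i

lemma isZero_cot_iff {n : ℕ} : IsZero ((cot n).obj X) ↔ ∀ i (x : X.obj i), x ∈ cotKernel n X i := by
  rw [isZero_iff]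
  refine ⟨fun h i x => ?_, fun h i => ⟨fun a b => ?_⟩⟩
  · exact (QuotientGroup.eq_one_iff x).1 ((h i).elim _ _)
  · obtain ⟨x, rfl⟩ := QuotientGroup.mk_surjective a
    obtain ⟨y, rfl⟩ := QuotientGroup.mk_surjective b
    exact QuotientGroup.eq.2 (h i _)

lemma mooreLE_of_surj {n : ℕ} {f : X ⟶ Y} (hf : Surj f) (hX : mooreLE n X) : mooreLE n Y := by
  intro k hk
  rw [eq_bot_iff]
  intro y hy
  obtain ⟨x, hx, rfl⟩ := hf.exists_mem_moore hy
  rw [hX k hk, Subgroup.mem_bot] at hx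
  rw [hx, map_one]
  exact one_mem _

lemma mooreLE_quot_cotKer (n : ℕ) (X : SimpGrp.{u}) : mooreLE n (cotKer n X).quot := by
  intro k hk
  rw [eq_bot_iff]
  intro y hy
  obtain ⟨x, hx, rfl⟩ := (cotKer n X).proj_surj.exists_mem_moore hy
  exact ((cotKer n X).proj_eq_one_iff x).2 (moore_le_cotKernel hk hx)

/-- A boundary of X in degree n is still a boundary inside `cotKer n X`, because the latter contains
all of M_{n+1}. -/
lemma isZero_cot_cotKer (n : ℕ) (X : SimpGrp.{u}) :
    IsZero ((cot n).obj (cotKer n X).toSimpGrp) := by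
  rw [isZero_cot_iff]
  intro i x
  have hx : x.1 ∈ cotKernel n X i := x.2
  simp only [cotKernel, Subgroup.mem_iInf, Subgroup.mem_comap] at hx ⊢
  intro θ
  obtain ⟨z, hz, hzx⟩ := hx θ
  refine ⟨(⟨z, moore_le_cotKernel n.lt_succ_self hz⟩ : (cotKer n X).carrier _), ?_, ?_⟩
  · exact mem_moore_of_inj (cotKer n X).incl_inj hz
  · exact (cotKer n X).incl_inj _ hzx

/-- If the Moore complex of `X` vanishes above degree `n`, then the elements of `X` are determined
by their images in degree `n`. -/
lemma eq_one_of_mooreLE {n : ℕ} (hX : mooreLE n X) {k : ℕ} (x : X _⦋k⦌)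
    (hx : ∀ θ : ⦋n⦌ ⟶ ⦋k⦌, (X.map θ.op).hom x = 1) : x = 1 := by
  induction k with
  | zero =>
    -- ⦋0⦌ is a retract of ⦋n⦌, so the degenerate image of x in degree n determines x.
    have h := hx (SimplexCategory.const ⦋n⦌ ⦋0⦌ 0)
    have h1 := congrArg (X.map (SimplexCategory.const ⦋0⦌ ⦋n⦌ 0).op).hom h
    rw [map_one] at h1
    have h2 : SimplexCategory.const ⦋0⦌ ⦋n⦌ 0 ≫ SimplexCategory.const ⦋n⦌ ⦋0⦌ 0 = 𝟙 _ :=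
      SimplexCategory.hom_zero_zero _
    have h3 := ConcreteCategory.congr_hom (X.map_comp (SimplexCategory.const ⦋n⦌ ⦋0⦌ 0).op
      (SimplexCategory.const ⦋0⦌ ⦋n⦌ 0).op) x
    rw [← op_comp, h2, op_id, X.map_id] at h3
    exact h3.trans h1
  | succ k ih =>
    have hface (i : Fin (k + 2)) : (X.δ i).hom x = 1 := by
      refine ih _ fun θ => ?_
      have h := hx (θ ≫ SimplexCategory.δ i)
      rw [op_comp, X.map_comp] at h
      exact h
    -- Above degree n, trivial faces put x in a vanishing Moore term. Otherwise ⦋k + 1⦌ is a retract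
    -- of ⦋n⦌, via inclusion and truncation at k + 1.
    by_cases hk : n < k + 1
    · have hx' : x ∈ moore X (k + 1) := by
        simp only [moore, Subgroup.mem_iInf, MonoidHom.mem_ker]
        exact fun i => hface _
      rwa [hX _ hk, Subgroup.mem_bot] at hx'
    · let s : ⦋k + 1⦌ ⟶ ⦋n⦌ := SimplexCategory.mkHom
        ⟨Fin.castLE (by omega), fun a b h => h⟩
      let r : ⦋n⦌ ⟶ ⦋k + 1⦌ := SimplexCategory.mkHom
        ⟨fun a => ⟨min a.1 (k + 1), by omega⟩, fun a b h => by
          have : a.1 ≤ b.1 := h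
          exact Fin.mk_le_mk.2 (by omega)⟩
      have hsr : s ≫ r = 𝟙 _ := by
        ext a
        have : a.1 < k + 2 := a.2
        change min a.1 (k + 1) = a.1
        omega
      have h1 := congrArg (X.map s.op).hom (hx r)
      rw [map_one] at h1
      have h3 := ConcreteCategory.congr_hom (X.map_comp r.op s.op) x
      rw [← op_comp, hsr, op_id, X.map_id] at h3
      exact h3.trans h1

theorem isCohereditaryTorsionTheory_muLE (n : ℕ) :
    (muLE.{u} n).IsCohereditaryTorsionTheory where
  torsion_replete := ⟨fun e h => h.of_iso ((cot n).mapIso e.symm)⟩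
  torsionFree_replete := ⟨fun e h => mooreLE_of_surj (Surj.of_isIso e.hom) h⟩
  hom_eq_zero T F f hT hF := by
    refine hom_ext_apply fun i x => ?_
    obtain ⟨⟨k⟩⟩ := i
    refine eq_one_of_mooreLE hF _ fun θ => ?_
    have h := isZero_cot_iff.1 hT _ x
    simp only [cotKernel, Subgroup.mem_iInf, Subgroup.mem_comap] at h
    -- The image lies in the boundary of F, which is trivial since M_{n+1}(F) is.
    have h1 := mooreBoundary_le_comap n f (h θ.op)
    rw [mooreBoundary, hF _ n.lt_succ_self, Subgroup.map_bot] at h1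
    exact (naturality_apply f θ.op x).symm.trans h1
  exists_ses X := ⟨_, _, _, _, isZero_cot_cotKer n X, mooreLE_quot_cotKer n X,
    (cotKer n X).isShortExactSeq⟩
  closed_quot _ _ _ hp hX := mooreLE_of_surj (surj_of_normalEpi hp) hX

/-! ### The torsion theory `μ_{≥n}` -/

lemma isZero_truncation_iff {m : ℕ} : IsZero ((SimplicialObject.truncation m).obj X) ↔
    ∀ k ≤ m, Subsingleton (X _⦋k⦌) := by
  rw [Functor.isZero_iff]
  refine ⟨fun h k hk => ?_, fun h i => ?_⟩
  · exact GrpCat.isZero_iff_subsingleton.1 (h (op ⟨⦋k⦌, hk⟩))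
  · obtain ⟨⟨⟨k⟩, hk⟩⟩ := i
    exact GrpCat.isZero_iff_subsingleton.2 (h k hk)

/-- The elements of `X` all of whose images in degrees at most `m` are trivial. -/
def truncKer (m : ℕ) (X : SimpGrp.{u}) : SimplicialSubgroup X where
  carrier i := ⨅ k : Fin (m + 1), ⨅ θ : i ⟶ op ⦋k⦌, (X.map θ).hom.ker
  le_comap {i j} α x hx := by
    simp only [Subgroup.mem_iInf, Subgroup.mem_comap, MonoidHom.mem_ker] at hx ⊢
    intro k θ
    have h := hx k (α ≫ θ)
    rw [X.map_comp] at h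
    exact h

instance (m : ℕ) (X : SimpGrp.{u}) (i) : ((truncKer m X).carrier i).Normal :=
  Subgroup.normal_iInf_normal fun _ => Subgroup.normal_iInf_normal fun _ => inferInstance

lemma mem_truncKer {m : ℕ} {i : SimplexCategoryᵒᵖ} {x : X.obj i} :
    x ∈ (truncKer m X).carrier i ↔ ∀ k ≤ m, ∀ θ : i ⟶ op ⦋k⦌, (X.map θ).hom x = 1 := by
  simp only [truncKer, Subgroup.mem_iInf, MonoidHom.mem_ker]
  exact ⟨fun h k hk => h ⟨k, by omega⟩, fun h k => h k (by omega)⟩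

/-- Composition with the unit is the adjoint transpose of truncation. This lemma and the next are
all that is used about the coskeleton in comparing morphisms. -/
lemma truncation_map_eq_of_comp_unit_eq {m : ℕ} {f g : X ⟶ Y}
    (h : f ≫ (SimplicialObject.coskAdj m).unit.app Y =
      g ≫ (SimplicialObject.coskAdj m).unit.app Y) :
    (SimplicialObject.truncation m).map f = (SimplicialObject.truncation m).map g := by
  apply ((SimplicialObject.coskAdj m).homEquiv _ _).injective
  simpa [Adjunction.homEquiv_unit] using h

lemma comp_unit_eq_of_truncation_map_eq {m : ℕ} {f g : X ⟶ Y}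
    (h : (SimplicialObject.truncation m).map f = (SimplicialObject.truncation m).map g) :
    f ≫ (SimplicialObject.coskAdj m).unit.app Y =
      g ≫ (SimplicialObject.coskAdj m).unit.app Y := by
  have h1 := congrArg ((SimplicialObject.coskAdj m).homEquiv _ _) h
  simpa [Adjunction.homEquiv_unit] using h1

/-- If f and g agree in degrees at most m, every operator to such a degree kills f(w) g(w)⁻¹. -/
lemma mono_unit_of_truncKer_eq_bot {m : ℕ} (h : ∀ i, (truncKer m X).carrier i = ⊥) :
    Mono ((SimplicialObject.coskAdj m).unit.app X) where
  right_cancellation {W} f g hfg := by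
    replace hfg := truncation_map_eq_of_comp_unit_eq hfg
    refine hom_ext_apply fun i w => ?_
    rw [← mul_inv_eq_one, ← Subgroup.mem_bot, ← h i, mem_truncKer]
    intro k hk θ
    rw [map_mul, map_inv, mul_inv_eq_one, ← naturality_apply, ← naturality_apply]
    exact ConcreteCategory.congr_hom (NatTrans.congr_app hfg (op ⟨⦋k⦌, hk⟩)) _

theorem isHereditaryTorsionTheory_muGESucc (m : ℕ) :
    (muGESucc.{u} m).IsHereditaryTorsionTheory where
  torsion_replete := ⟨fun e h => h.of_iso ((SimplicialObject.truncation m).mapIso e.symm)⟩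
  torsionFree_replete := ⟨fun {X Y} e h => by
    have h' : Mono ((SimplicialObject.coskAdj m).unit.app X) := h
    have h1 := (SimplicialObject.coskAdj m).unit.naturality e.inv
    have h2 : Mono ((SimplicialObject.coskAdj m).unit.app Y ≫
        (SimplicialObject.truncation m ⋙ SimplicialObject.Truncated.cosk m).map e.inv) := by
      rw [← h1]
      exact mono_comp _ _
    exact @mono_of_mono _ _ _ _ _ _ _ h2⟩
  hom_eq_zero T F f hT hF := by
    have hF' : Mono ((SimplicialObject.coskAdj m).unit.app F) := hF
    rw [← cancel_mono ((SimplicialObject.coskAdj m).unit.app F)]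
    exact comp_unit_eq_of_truncation_map_eq (IsZero.eq_of_src hT _ _)
  exists_ses X := by
    refine ⟨_, _, _, _, ?_, ?_, (truncKer m X).isShortExactSeq⟩
    · refine isZero_truncation_iff.2 fun k hk => ⟨fun a b => (truncKer m X).incl_inj _ ?_⟩
      have h (c : (truncKer m X).carrier (op ⦋k⦌)) : c.1 = 1 := by
        have := mem_truncKer.1 c.2 k hk (𝟙 _)
        rw [X.map_id] at this
        exact this
      exact (h a).trans (h b).symm
    · refine mono_unit_of_truncKer_eq_bot fun i => eq_bot_iff.2 fun y hy => ?_
      obtain ⟨x, rfl⟩ := (truncKer m X).proj_surj i y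
      rw [mem_truncKer] at hy
      refine ((truncKer m X).proj_eq_one_iff x).2 (mem_truncKer.2 fun k hk θ => ?_)
      have h1 := hy k hk θ
      -- The image of x under θ lies in `truncKer` in degree k ≤ m; the identity operator there
      -- shows it is trivial.
      rw [← naturality_apply, SimplicialSubgroup.proj_eq_one_iff, mem_truncKer] at h1
      have h2 := h1 k hk (𝟙 _)
      rw [X.map_id] at h2
      exact h2
  closed_sub X Y f _ hY := isZero_truncation_iff.2 fun k hk =>
    have := isZero_truncation_iff.1 hY k hk
    (Inj.of_mono f (op ⦋k⦌)).subsingleton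

end SimpGrp

/-! ### Binary coproducts of groups and of simplicial groups -/

instance : HasBinaryCoproducts GrpCat.{u} :=
  have (A B : GrpCat.{u}) : HasColimit (pair A B) :=
    ⟨⟨⟨BinaryCofan.mk (P := GrpCat.of (Monoid.Coprod A B)) (GrpCat.ofHom Monoid.Coprod.inl)
      (GrpCat.ofHom Monoid.Coprod.inr),
      BinaryCofan.isColimitMk (fun s => GrpCat.ofHom (Monoid.Coprod.lift s.inl.hom s.inr.hom))
        (fun s => by
          ext x
          exact Monoid.Coprod.lift_apply_inl s.inl.hom s.inr.hom x)
        (fun s => by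
          ext x
          exact Monoid.Coprod.lift_apply_inr s.inl.hom s.inr.hom x)
        (fun s m h₁ h₂ => by
          refine GrpCat.hom_ext (Monoid.Coprod.hom_ext ?_ ?_)
          · ext x
            refine (ConcreteCategory.congr_hom h₁ x).trans ?_
            exact (Monoid.Coprod.lift_apply_inl s.inl.hom s.inr.hom x).symm
          · ext x
            refine (ConcreteCategory.congr_hom h₂ x).trans ?_
            exact (Monoid.Coprod.lift_apply_inr s.inl.hom s.inr.hom x).symm)⟩⟩⟩
  hasBinaryCoproducts_of_hasColimit_pair _

namespace SimpGrp

instance : HasBinaryCoproducts SimpGrp.{u} :=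
  inferInstanceAs (HasBinaryCoproducts (SimplexCategoryᵒᵖ ⥤ GrpCat.{u}))

/-! ### Varieties of simplicial groups are semi-abelian -/

/-- A class of simplicial groups which contains every simplicial group whose elements are
separated by morphisms to members of the class, and every quotient of a member of the class. -/
structure IsVariety (P : ObjectProperty SimpGrp.{u}) : Prop where
  of_separated : ∀ X : SimpGrp.{u}, (∀ i (x : X.obj i), (∀ (Y : SimpGrp.{u}) (f : X ⟶ Y),
    P Y → (f.app i).hom x = 1) → x = 1) → P X
  of_surj : ∀ {X Y : SimpGrp.{u}} (f : X ⟶ Y), Surj f → P X → P Y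

/-- Morphisms carry Moore elements to Moore elements, so every morphism to a member kills M_k(X) for
k in S; surjections lift Moore elements, which handles quotients. -/
lemma isVariety_of_iff_moore (S : Set ℕ) {P : ObjectProperty SimpGrp.{u}}
    (hP : ∀ X, P X ↔ ∀ k ∈ S, moore X k = ⊥) : IsVariety P where
  of_separated X h := (hP X).2 fun k hk => eq_bot_iff.2 fun x hx => h _ x fun Y f hY => by
    have h1 := app_mem_moore f hx
    rwa [(hP Y).1 hY k hk, Subgroup.mem_bot] at h1
  of_surj {X Y} f hf hX := (hP Y).2 fun k hk => eq_bot_iff.2 fun y hy => by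
    obtain ⟨x, hx, rfl⟩ := hf.exists_mem_moore hy
    rw [(hP X).1 hX k hk, Subgroup.mem_bot] at hx
    rw [hx, map_one]
    exact one_mem _

namespace IsVariety

variable {P : ObjectProperty SimpGrp.{u}} (hP : IsVariety P)

include hP

/-! ### Limits in a variety, computed on elements -/

lemma of_inj {X Y : SimpGrp.{u}} (f : X ⟶ Y) (hf : Inj f) (hY : P Y) : P X :=
  hP.of_separated X fun i _ h => hf i ((h Y f hY).trans (map_one _).symm)

lemma hasZeroObject : HasZeroObject P.FullSubcategory := by
  let Z : SimpGrp.{u} := (Functor.const _).obj (GrpCat.of PUnit)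
  have hZ : P Z := hP.of_separated Z fun _ _ _ => rfl
  refine ⟨⟨Z, hZ⟩, ⟨fun X => ⟨⟨⟨P.homMk (0 : Z ⟶ X.obj)⟩, fun f => ?_⟩⟩,
    fun X => ⟨⟨⟨P.homMk (0 : X.obj ⟶ Z)⟩, fun f => ?_⟩⟩⟩⟩
  · refine ObjectProperty.hom_ext _ (hom_ext_apply fun i _ => ?_)
    exact map_one (f.hom.app i).hom
  · exact ObjectProperty.hom_ext _ (hom_ext_apply fun _ _ => rfl)

/-- The projections of a limit land in members of P and separate its elements. -/
lemma isClosedUnderLimitsOfShape (J : Type) [SmallCategory J] :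
    P.IsClosedUnderLimitsOfShape J where
  limitsOfShape_le := by
    rintro X ⟨h⟩
    refine hP.of_separated X fun i x hx => ?_
    have hl := isLimitOfPreserves ((evaluation _ _).obj i) h.isLimit
    refine Concrete.isLimit_ext _ hl _ _ fun j => ?_
    exact (hx _ (h.π.app j) (h.prop_diag_obj j)).trans (map_one (h.π.app j |>.app i).hom).symm

lemma hasFiniteLimits : HasFiniteLimits P.FullSubcategory :=
  ⟨fun J _ _ =>
    have := hP.isClosedUnderLimitsOfShape J
    inferInstance⟩

variable {R A B X : P.FullSubcategory} {a : R ⟶ A} {b : R ⟶ B} {f : A ⟶ X} {g : B ⟶ X}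

lemma isPullback_eval (h : IsPullback a b f g) (i : SimplexCategoryᵒᵖ) :
    IsPullback ((forget GrpCat).map (a.hom.app i)) ((forget GrpCat).map (b.hom.app i))
      ((forget GrpCat).map (f.hom.app i)) ((forget GrpCat).map (g.hom.app i)) :=
  have := hP.isClosedUnderLimitsOfShape WalkingCospan
  ((h.map P.ι).map ((evaluation _ _).obj i)).map (forget GrpCat)

lemma exists_of_isPullback (h : IsPullback a b f g) {i : SimplexCategoryᵒᵖ} (x : A.obj.obj i)
    (y : B.obj.obj i) (hxy : (f.hom.app i).hom x = (g.hom.app i).hom y) :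
    ∃ r : R.obj.obj i, (a.hom.app i).hom r = x ∧ (b.hom.app i).hom r = y :=
  Types.exists_of_isPullback (hP.isPullback_eval h i) x y hxy

lemma ext_of_isPullback (h : IsPullback a b f g) {i : SimplexCategoryᵒᵖ} {r s : R.obj.obj i}
    (h₁ : (a.hom.app i).hom r = (a.hom.app i).hom s)
    (h₂ : (b.hom.app i).hom r = (b.hom.app i).hom s) : r = s :=
  Types.ext_of_isPullback (hP.isPullback_eval h i) h₁ h₂

omit hP in
/-- A jointly injective pair `p₁, p₂` whose image consists of the pairs with the same image
under `q` is the kernel pair of `q`. -/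
lemma isKernelPair_of_exists {R X Y : P.FullSubcategory} {p₁ p₂ : R ⟶ X} {q : X ⟶ Y}
    (w : p₁ ≫ q = p₂ ≫ q)
    (hinj : ∀ i (r : R.obj.obj i), (p₁.hom.app i).hom r = 1 → (p₂.hom.app i).hom r = 1 → r = 1)
    (h : ∀ i (x y : X.obj.obj i), (q.hom.app i).hom x = (q.hom.app i).hom y →
      ∃ r, (p₁.hom.app i).hom r = x ∧ (p₂.hom.app i).hom r = y) : IsKernelPair q p₁ p₂ := by
  have hext {i} {r s : R.obj.obj i} (h₁ : (p₁.hom.app i).hom r = (p₁.hom.app i).hom s)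
      (h₂ : (p₂.hom.app i).hom r = (p₂.hom.app i).hom s) : r = s := by
    rw [← mul_inv_eq_one]
    apply hinj
    · rw [map_mul, map_inv, h₁, mul_inv_cancel]
    · rw [map_mul, map_inv, h₂, mul_inv_cancel]
  have hlift {Z : P.FullSubcategory} (s t : Z ⟶ X) (hst : s ≫ q = t ≫ q) :
      ∃ l : Z ⟶ R, l ≫ p₁ = s ∧ l ≫ p₂ = t := by
    have hst' (i) (z : Z.obj.obj i) := h i ((s.hom.app i).hom z) ((t.hom.app i).hom z)
      (ConcreteCategory.congr_hom (NatTrans.congr_app (congrArg (·.hom) hst) i) z)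
    choose l hl₁ hl₂ using hst'
    -- Joint injectivity makes the elementwise choice multiplicative and natural.
    refine ⟨P.homMk { app := fun i => GrpCat.ofHom (MonoidHom.mk' (l i) fun x y => hext ?_ ?_),
                      naturality := fun i j α => ?_ }, ?_, ?_⟩
    · rw [map_mul, hl₁, hl₁, hl₁, map_mul]
    · rw [map_mul, hl₂, hl₂, hl₂, map_mul]
    · ext x
      change l j ((Z.obj.map α).hom x) = (R.obj.map α).hom (l i x)
      apply hext
      · rw [naturality_apply, hl₁, hl₁, naturality_apply]
      · rw [naturality_apply, hl₂, hl₂, naturality_apply]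
    · exact ObjectProperty.hom_ext _ (hom_ext_apply hl₁)
    · exact ObjectProperty.hom_ext _ (hom_ext_apply hl₂)
  refine ⟨⟨w⟩, ⟨PullbackCone.IsLimit.mk w (fun s => (hlift s.fst s.snd s.condition).choose)
    (fun s => (hlift s.fst s.snd s.condition).choose_spec.1)
    (fun s => (hlift s.fst s.snd s.condition).choose_spec.2) fun s m h₁ h₂ => ?_⟩⟩
  have hs := (hlift s.fst s.snd s.condition).choose_spec
  refine ObjectProperty.hom_ext _ (hom_ext_apply fun i z => hext ?_ ?_)
  · exact ConcreteCategory.congr_hom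
      (NatTrans.congr_app (congrArg (·.hom) (h₁.trans hs.1.symm)) i) z
  · exact ConcreteCategory.congr_hom
      (NatTrans.congr_app (congrArg (·.hom) (h₂.trans hs.2.symm)) i) z

omit hP in
/-- A surjection is the coequalizer of any pair which generates its kernel. -/
lemma nonempty_isColimit_cofork {R X Y : P.FullSubcategory} {p₁ p₂ : R ⟶ X} {q : X ⟶ Y}
    (w : p₁ ≫ q = p₂ ≫ q) (hq : Surj q.hom)
    (h : ∀ i (x : X.obj.obj i), (q.hom.app i).hom x = 1 →
      ∃ r, (p₁.hom.app i).hom r = x ∧ (p₂.hom.app i).hom r = 1) :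
    Nonempty (IsColimit (Cofork.ofπ q w)) := by
  have hdesc (s : Cofork p₁ p₂) : ∃ l : Y ⟶ s.pt, q ≫ l = s.π := by
    obtain ⟨l, hl⟩ := hq.exists_desc s.π.hom fun i x hx => by
      obtain ⟨r, rfl, hr⟩ := h i x hx
      have hs := ConcreteCategory.congr_hom
        (NatTrans.congr_app (congrArg (·.hom) s.condition) i) r
      exact hs.trans ((congrArg (s.π.hom.app i).hom hr).trans (map_one _))
    exact ⟨P.homMk l, ObjectProperty.hom_ext _ hl⟩
  exact ⟨Cofork.IsColimit.mk _ (fun s => (hdesc s).choose) (fun s => (hdesc s).choose_spec)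
    fun s m hm => ObjectProperty.hom_ext _
      (hq.cancel (congrArg (·.hom) (hm.trans (hdesc s).choose_spec.symm)))⟩

/-- The image lies in P as a subobject of Y, so a coequalizer induces a section of the image
inclusion. Conversely, a surjection is the coequalizer of its kernel pair. -/
lemma isRegularEpi_iff_surj {X Y : P.FullSubcategory} (f : X ⟶ Y) :
    IsRegularEpi f ↔ Surj f.hom := by
  constructor
  · rintro ⟨⟨hf⟩⟩
    let I : P.FullSubcategory :=
      ⟨(range f.hom).toSimpGrp, hP.of_inj _ (range f.hom).incl_inj Y.property⟩
    have h : hf.left ≫ (P.homMk (toRange f.hom) : X ⟶ I) = hf.right ≫ P.homMk (toRange f.hom) :=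
      ObjectProperty.hom_ext _ ((range f.hom).incl_inj.cancel (congrArg (·.hom) hf.w))
    obtain ⟨s, hs⟩ := Cofork.IsColimit.desc' hf.isColimit _ h
    replace hs : f ≫ s = P.homMk (toRange f.hom) := hs
    have := hf.epi
    have h1 : s ≫ (P.homMk (range f.hom).incl : I ⟶ Y) = 𝟙 Y := by
      rw [← cancel_epi f, ← Category.assoc, hs, Category.comp_id]
      rfl
    exact Surj.of_section_incl (congrArg (·.hom) h1)
  · intro hf
    have := hP.hasFiniteLimits
    have hpb := IsPullback.of_hasPullback f f
    have h := nonempty_isColimit_cofork hpb.w hf fun i x hx =>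
      hP.exists_of_isPullback hpb x 1 (hx.trans (map_one _).symm)
    exact ⟨⟨regularEpiOfKernelPair f h.some⟩⟩

lemma regular : Regular P.FullSubcategory where
  toHasFiniteLimits := hP.hasFiniteLimits
  hasCoequalizer_of_isKernelPair {X Y R} f g₁ g₂ h := by
    let I : P.FullSubcategory :=
      ⟨(range f.hom).toSimpGrp, hP.of_inj _ (range f.hom).incl_inj Y.property⟩
    have w : g₁ ≫ (P.homMk (toRange f.hom) : X ⟶ I) = g₂ ≫ P.homMk (toRange f.hom) :=
      ObjectProperty.hom_ext _ ((range f.hom).incl_inj.cancel (congrArg (·.hom) h.w))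
    exact ⟨⟨⟨_, (nonempty_isColimit_cofork w (toRange_surj f.hom) fun i x hx =>
      hP.exists_of_isPullback h x 1
        ((congrArg Subtype.val hx).trans (map_one (f.hom.app i).hom).symm)).some⟩⟩⟩
  regularEpiIsStableUnderBaseChange :=
    { of_isPullback := fun {X Y X' Y'} f g f' g' sq hg => by
        rw [MorphismProperty.regularEpi_iff, hP.isRegularEpi_iff_surj] at hg ⊢
        intro i y
        obtain ⟨x, hx⟩ := hg i ((f.hom.app i).hom y)
        obtain ⟨r, -, hr⟩ := hP.exists_of_isPullback sq x y hx
        exact ⟨r, hr⟩ }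

/-- The class of 1 is N = p₁(ker p₂), normal because reflexivity makes p₁ surjective. The relation
is congruence modulo N, and X/N stays in P. -/
lemma effective {R X : P.FullSubcategory} (p₁ p₂ : R ⟶ X) (h : IsEquivalenceRelation p₁ p₂) :
    ∃ (Y : P.FullSubcategory) (f : X ⟶ Y), IsKernelPair f p₁ p₂ := by
  obtain ⟨⟨e⟩⟩ := h
  have hr₁ (i) (x : X.obj.obj i) : (p₁.hom.app i).hom ((e.r.hom.app i).hom x) = x :=
    ConcreteCategory.congr_hom (NatTrans.congr_app (congrArg (·.hom) e.reflexivity₁) i) x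
  have hr₂ (i) (x : X.obj.obj i) : (p₂.hom.app i).hom ((e.r.hom.app i).hom x) = x :=
    ConcreteCategory.congr_hom (NatTrans.congr_app (congrArg (·.hom) e.reflexivity₂) i) x
  let N : SimplicialSubgroup X.obj :=
    { carrier := fun i => (p₂.hom.app i).hom.ker.map (p₁.hom.app i).hom
      le_comap := fun {i j} α => by
        rintro _ ⟨r, hr, rfl⟩
        refine ⟨(R.obj.map α).hom r, ?_, naturality_apply p₁.hom α r⟩
        rw [SetLike.mem_coe, MonoidHom.mem_ker] at hr ⊢
        rw [naturality_apply, hr, map_one] }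
  have hN (i) : (N.carrier i).Normal :=
    Subgroup.Normal.map inferInstance _ fun x => ⟨_, hr₁ i x⟩
  refine ⟨⟨N.quot, hP.of_surj _ N.proj_surj X.property⟩, P.homMk N.proj,
    isKernelPair_of_exists ?_ ?_ ?_⟩
  · refine ObjectProperty.hom_ext _ (hom_ext_apply fun i r => ?_)
    change (N.proj.app i).hom ((p₁.hom.app i).hom r) = (N.proj.app i).hom ((p₂.hom.app i).hom r)
    rw [← mul_inv_eq_one, ← map_inv, ← map_mul, N.proj_eq_one_iff]
    refine ⟨r * ((e.r.hom.app i).hom ((p₂.hom.app i).hom r))⁻¹, ?_, ?_⟩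
    · rw [SetLike.mem_coe, MonoidHom.mem_ker, map_mul, map_inv, hr₂, mul_inv_cancel]
    · rw [map_mul, map_inv, hr₁]
  -- Joint monicity only tests against objects of P; ker p₁ ⊓ ker p₂ is one, being a subobject of R.
  · let K : SimplicialSubgroup R.obj :=
      { carrier := fun i => (p₁.hom.app i).hom.ker ⊓ (p₂.hom.app i).hom.ker
        le_comap := fun {i j} α r hr => by
          simp only [Subgroup.mem_inf, MonoidHom.mem_ker, Subgroup.mem_comap] at hr ⊢
          rw [naturality_apply, naturality_apply, hr.1, hr.2]
          exact ⟨map_one (X.obj.map α).hom, map_one (X.obj.map α).hom⟩ }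
    let K' : P.FullSubcategory := ⟨K.toSimpGrp, hP.of_inj _ K.incl_inj R.property⟩
    have hK : (P.homMk K.incl : K' ⟶ R) = P.homMk 0 := by
      apply e.right_cancellation
      · refine ObjectProperty.hom_ext _ (hom_ext_apply fun i r => ?_)
        exact (MonoidHom.mem_ker.1 r.2.1).trans (map_one (p₁.hom.app i).hom).symm
      · refine ObjectProperty.hom_ext _ (hom_ext_apply fun i r => ?_)
        exact (MonoidHom.mem_ker.1 r.2.2).trans (map_one (p₂.hom.app i).hom).symm
    intro i r h₁ h₂
    exact ConcreteCategory.congr_hom (NatTrans.congr_app (congrArg (·.hom) hK) i)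
      (⟨r, h₁, h₂⟩ : K.carrier i)
  · intro i x y hxy
    change (N.proj.app i).hom x = (N.proj.app i).hom y at hxy
    rw [← mul_inv_eq_one, ← map_inv, ← map_mul, N.proj_eq_one_iff] at hxy
    obtain ⟨r, hr, hr'⟩ := hxy
    rw [SetLike.mem_coe, MonoidHom.mem_ker] at hr
    refine ⟨r * (e.r.hom.app i).hom y, ?_, ?_⟩
    · rw [map_mul, hr', hr₁, inv_mul_cancel_right]
    · rw [map_mul, hr, hr₂, one_mul]

/-- Pullback elements over 1 in E are the elements of ker f, so the hypothesis makes g bijective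
between ker f and ker f'. The splitting y = (y · s'f'(y)⁻¹) · s'f'(y) then extends surjectivity to
all of A'. -/
lemma isProtomodular [HasPullbacks P.FullSubcategory] : IsProtomodular P.FullSubcategory := by
  intro E B A A' p f s f' s' g hs hs' hf hg hiso
  have hfg (i) (x : A.obj.obj i) : (f'.hom.app i).hom ((g.hom.app i).hom x) =
      (f.hom.app i).hom x :=
    ConcreteCategory.congr_hom (NatTrans.congr_app (congrArg (·.hom) hf) i) x
  have hsg (i) (b : B.obj.obj i) : (g.hom.app i).hom ((s.hom.app i).hom b) =
      (s'.hom.app i).hom b :=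
    ConcreteCategory.congr_hom (NatTrans.congr_app (congrArg (·.hom) hg) i) b
  have hsf (i) (b : B.obj.obj i) : (f'.hom.app i).hom ((s'.hom.app i).hom b) = b :=
    ConcreteCategory.congr_hom (NatTrans.congr_app (congrArg (·.hom) hs') i) b
  have h₁ := IsPullback.of_hasPullback f p
  have h₂ := IsPullback.of_hasPullback f' p
  set φ := pullback.map f p f' p g (𝟙 E) (𝟙 B) (by simp [hf]) (by simp)
  have hφ₁ : φ ≫ pullback.fst f' p = pullback.fst f p ≫ g := pullback.lift_fst _ _ _
  have hφ₂ : φ ≫ pullback.snd f' p = pullback.snd f p ≫ 𝟙 E := pullback.lift_snd _ _ _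
  have hφ₁' (i) (r : (pullback f p).obj.obj i) :
      ((pullback.fst f' p).hom.app i).hom ((φ.hom.app i).hom r) =
        (g.hom.app i).hom (((pullback.fst f p).hom.app i).hom r) :=
    ConcreteCategory.congr_hom (NatTrans.congr_app (congrArg (·.hom) hφ₁) i) r
  have hφ₂' (i) (r : (pullback f p).obj.obj i) :
      ((pullback.snd f' p).hom.app i).hom ((φ.hom.app i).hom r) =
        ((pullback.snd f p).hom.app i).hom r :=
    ConcreteCategory.congr_hom (NatTrans.congr_app (congrArg (·.hom) hφ₂) i) r
  have hφ : IsIso φ.hom := inferInstanceAs (IsIso (P.ι.map φ))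
  have hinj : Inj g.hom := by
    intro i
    rw [injective_iff_map_eq_one]
    intro x hx
    have hfx : (f.hom.app i).hom x = 1 := by rw [← hfg, hx, map_one]
    obtain ⟨r, hr, hr'⟩ := hP.exists_of_isPullback h₁ x 1 (hfx.trans (map_one _).symm)
    have hr1 : r = 1 := by
      apply Inj.of_isIso φ.hom i
      rw [map_one]
      apply hP.ext_of_isPullback h₂
      · rw [hφ₁', hr, hx, map_one]
      · rw [hφ₂', hr', map_one]
    rw [← hr, hr1, map_one]
  have hsurj : Surj g.hom := by
    intro i y
    obtain ⟨z, hz, hz'⟩ := hP.exists_of_isPullback h₂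
      (y * ((s'.hom.app i).hom ((f'.hom.app i).hom y))⁻¹) 1
      (by rw [map_mul, map_inv, hsf, mul_inv_cancel, map_one])
    obtain ⟨r, rfl⟩ := Surj.of_isIso φ.hom i z
    rw [hφ₁'] at hz
    refine ⟨((pullback.fst f p).hom.app i).hom r * (s.hom.app i).hom ((f'.hom.app i).hom y), ?_⟩
    rw [map_mul, hz, hsg, inv_mul_cancel_right]
  have : IsIso (P.ι.map g) := isIso_of_inj_of_surj hinj hsurj
  exact isIso_of_reflects_iso g P.ι

/-! ### Reflection into a variety and binary coproducts -/

omit hP in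
/-- The smallest normal simplicial subgroup of `X` with quotient in the variety `P`. -/
def verbalSubgroup (P : ObjectProperty SimpGrp.{u}) (X : SimpGrp.{u}) : SimplicialSubgroup X where
  carrier i := ⨅ (Y : SimpGrp.{u}) (f : X ⟶ Y) (_ : P Y), (f.app i).hom.ker
  le_comap {i j} α x hx := by
    simp only [Subgroup.mem_iInf, Subgroup.mem_comap, MonoidHom.mem_ker] at hx ⊢
    intro Y f hY
    rw [naturality_apply, hx Y f hY, map_one]

omit hP in
lemma mem_verbalSubgroup {X : SimpGrp.{u}} {i : SimplexCategoryᵒᵖ} {x : X.obj i} :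
    x ∈ (verbalSubgroup P X).carrier i ↔
      ∀ (Y : SimpGrp.{u}) (f : X ⟶ Y), P Y → (f.app i).hom x = 1 := by
  simp only [verbalSubgroup, Subgroup.mem_iInf, MonoidHom.mem_ker]

omit hP in
instance (X : SimpGrp.{u}) (i) : ((verbalSubgroup P X).carrier i).Normal :=
  Subgroup.normal_iInf_normal fun _ => Subgroup.normal_iInf_normal fun _ =>
    Subgroup.normal_iInf_normal fun _ => inferInstance

omit hP in
lemma exists_desc_verbalSubgroup {X Y : SimpGrp.{u}} (f : X ⟶ Y) (hY : P Y) :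
    ∃ l, (verbalSubgroup P X).proj ≫ l = f :=
  (verbalSubgroup P X).proj_surj.exists_desc f fun _ x hx =>
    mem_verbalSubgroup.1 ((SimplicialSubgroup.proj_eq_one_iff _ x).1 hx) Y f hY

/-- Morphisms from X to members factor through this quotient and separate its elements. -/
lemma prop_quot_verbalSubgroup (X : SimpGrp.{u}) : P (verbalSubgroup P X).quot := by
  refine hP.of_separated _ fun i y hy => ?_
  obtain ⟨x, rfl⟩ := (verbalSubgroup P X).proj_surj i y
  refine (SimplicialSubgroup.proj_eq_one_iff _ x).2 (mem_verbalSubgroup.2 fun Y f hY => ?_)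
  obtain ⟨l, rfl⟩ := exists_desc_verbalSubgroup f hY
  exact hy Y l hY

/-- The coproduct in P is the reflection of the coproduct of simplicial groups. -/
lemma hasBinaryCoproducts : HasBinaryCoproducts P.FullSubcategory := by
  have (A B : P.FullSubcategory) : HasColimit (pair A B) := by
    let Q : P.FullSubcategory := ⟨_, hP.prop_quot_verbalSubgroup (A.obj ⨿ B.obj)⟩
    let q : A.obj ⨿ B.obj ⟶ Q.obj := (verbalSubgroup P _).proj
    have hq : Surj q := (verbalSubgroup P _).proj_surj
    let inl : A ⟶ Q := P.homMk (coprod.inl ≫ q)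
    let inr : B ⟶ Q := P.homMk (coprod.inr ≫ q)
    have hdesc {T : P.FullSubcategory} (f : A ⟶ T) (g : B ⟶ T) :
        ∃ l : Q ⟶ T, inl ≫ l = f ∧ inr ≫ l = g := by
      obtain ⟨l, hl⟩ := exists_desc_verbalSubgroup (coprod.desc f.hom g.hom) T.property
      replace hl : q ≫ l = _ := hl
      refine ⟨P.homMk l, ObjectProperty.hom_ext _ ?_, ObjectProperty.hom_ext _ ?_⟩
      · change (coprod.inl ≫ q) ≫ l = f.hom
        rw [Category.assoc, hl, coprod.inl_desc]
      · change (coprod.inr ≫ q) ≫ l = g.hom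
        rw [Category.assoc, hl, coprod.inr_desc]
    have hext {T : P.FullSubcategory} {l m : Q ⟶ T} (h₁ : inl ≫ l = inl ≫ m)
        (h₂ : inr ≫ l = inr ≫ m) : l = m := by
      refine ObjectProperty.hom_ext _ (hq.cancel (coprod.hom_ext ?_ ?_))
      · rw [← Category.assoc, ← Category.assoc]
        exact congrArg (·.hom) h₁
      · rw [← Category.assoc, ← Category.assoc]
        exact congrArg (·.hom) h₂
    exact ⟨⟨⟨BinaryCofan.mk inl inr,
      BinaryCofan.isColimitMk (fun s => (hdesc s.inl s.inr).choose)
        (fun s => (hdesc s.inl s.inr).choose_spec.1) (fun s => (hdesc s.inl s.inr).choose_spec.2)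
        fun s m h₁ h₂ => hext (h₁.trans (hdesc s.inl s.inr).choose_spec.1.symm)
          (h₂.trans (hdesc s.inl s.inr).choose_spec.2.symm)⟩⟩⟩
  exact hasBinaryCoproducts_of_hasColimit_pair _

/-- A variety of simplicial groups is a semi-abelian category. -/
theorem isSemiAbelian : IsSemiAbelian P.FullSubcategory where
  regular := hP.regular
  effective _ _ p₁ p₂ h := hP.effective p₁ p₂ h
  pointed := hP.hasZeroObject
  protomodular :=
    have := hP.hasFiniteLimits
    hP.isProtomodular
  binaryCoproducts := hP.hasBinaryCoproducts

end IsVariety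

end SimpGrp

theorem mainTheorem10 :
    (∀ n : ℕ, (SimpGrp.muLE.{u} n).IsCohereditaryTorsionTheory) ∧
    (∀ m : ℕ, (SimpGrp.muGESucc.{u} m).IsHereditaryTorsionTheory) ∧
    (∀ n : ℕ, IsSemiAbelian (SimpGrp.mooreLE.{u} n).FullSubcategory) ∧
    (∀ n : ℕ, IsSemiAbelian (SimpGrp.mooreGE.{u} n).FullSubcategory) :=
  ⟨SimpGrp.isCohereditaryTorsionTheory_muLE, SimpGrp.isHereditaryTorsionTheory_muGESucc,
    fun n => (SimpGrp.isVariety_of_iff_moore (Set.Ioi n) fun _ => Iff.rfl).isSemiAbelian,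
    fun n => (SimpGrp.isVariety_of_iff_moore (Set.Iio n) fun _ => Iff.rfl).isSemiAbelian⟩
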